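/- Let $K$ be a field, let $m$ and $n$ be positive integers and let $\gamma_1,\ldots,\gamma_n$ be arbitrary integers. Let $K[x^m,x^{-m}]$ be $\mathbb Z$-graded by $K[x^m,x^{-m}]_{d}=Kx^{d}$ if $m\mid d$ and $K[x^m,x^{-m}]_d=0$ otherwise. For integers $\delta_1,\ldots,\delta_n$, let $\mathbb M_n(K[x^m,x^{-m}])(\delta_1,\ldots,\delta_n)$ be the algebra of $n\times n$ matrices over $K[x^m,x^{-m}]$, $\mathbb Z$-graded so that $(r_{ij})$ is in the $d$-component if and only if $r_{ij}\in K[x^m,x^{-m}]_{-\delta_i+d+\delta_j}$ for all $i,j$. Let $l_0(0),l_1(1),\ldots,l_{m-1}(m-1)$ denote the list in which $0$ appears $l_0$ times, followed by $1$ appearing $l_1$ times, and so on. For a directed graph $E$ (with arbitrary sets of vertices and edges), let $L_K(E)$ be its Leavitt path algebra: the (not necessarily unital) $K$-algebra generated by the vertices $v$, the edges $e$ and the ghost edges $e^*$, with source and range maps $\mathbf s,\mathbf r$, subject to $vw=0$ for $v\neq w$ and $vv=v$; $\mathbf s(e)e=e\mathbf r(e)=e$; $\mathbf r(e)e^*=e^*\mathbf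 s(e)=e^*$; $e^*f=0$ for $e\ne f$ and $e^*e=\mathbf r(e)$; and $v=\sum_{\mathbf s(e)=v}ee^*$ for every vertex $v$ which emits at least one and only finitely many edges. It is $\mathbb Z$-graded so that its $d$-component is the $K$-linear span of the elements $pq^*$ for paths $p,q$ (possibly trivial) with $|p|-|q|=d$. A cycle is a closed path of positive length whose edges have pairwise different sources, considered up to the choice of its starting vertex. A graph is finite if it has finitely many vertices and edges, and it is a comet if it has exactly one cycle and from every vertex there is a path to some vertex of that cycle. Let $R=\mathbb M_n(K[x^m,x^{-m}])(\gamma_1,\ldots,\gamma_n)$. The following conditions are equivalent. 1. $R$ is graded isomorphic to $L_K(E)$ for some graph $E$. 2. $R$ is graded isomorphic to $L_K(E)$ for some finite comet graph $E$. 3. $R$ is graded isomorphic to $\mathbb M_n(K[x^m,x^{-m}])(l_0(0),l_1(1),\ldots,l_{m-1}(m-1))$ for some positive integers $l_0,\ldots,l_{m-1}$ such that $n=\sum_{i=0}^{m-1}l_i$. 4. For every $i=0,\ldots,m-1$, the number of indices $j$ with $\gamma_j\equiv i \pmod m$ is positive. 5. For all integers $\gamma'_1,\ldots,\gamma'_n$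 such that $R$ is graded isomorphic to $\mathbb M_n(K[x^m,x^{-m}])(\gamma'_1,\ldots,\gamma'_n)$ and every $i=0,\ldots,m-1$, the number of indices $j$ with $\gamma'_j\equiv i\pmod m$ is positive. This holds both when "graded isomorphic" means graded isomorphic as rings throughout and when it means graded isomorphic as $K$-algebras throughout. -/

import Mathlib

open scoped LaurentPolynomial

universe u v w

/-! ## Directed graphs

A directed graph is a quiver on its type `V` of vertices; its edges are the elements of
`Quiver.Total V`, with source `left` and range `right`, and the edges emitted by a vertex `a` are
the elements of `Quiver.Star a`. -/

/-- A graph is finite if it has finitely many vertices and finitely many edges. -/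
def IsFiniteGraph (V : Type u) [Quiver.{v} V] : Prop :=
  Finite V ∧ Finite (Quiver.Total V)

/-- A cycle of a graph: a nonempty closed path whose edges have pairwise different sources.
Cycles are lists of edges up to rotation, so the choice of the base vertex does not matter. -/
def IsGraphCycle {V : Type u} [Quiver.{v} V] (c : Cycle (Quiver.Total V)) : Prop :=
  c ≠ Cycle.nil ∧ c.Chain (fun e f => e.right = f.left) ∧ (c.map Quiver.Total.left).Nodup

/-- A comet: the graph has exactly one cycle and every vertex connects to it, that is, for every
vertex there is a (possibly trivial) path from it to some vertex of the cycle. -/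
def IsComet (V : Type u) [Quiver.{v} V] : Prop :=
  ∃ c : Cycle (Quiver.Total V), IsGraphCycle c ∧
    (∀ c' : Cycle (Quiver.Total V), IsGraphCycle c' → c' = c) ∧
    ∀ a : V, ∃ e ∈ c, Nonempty (Quiver.Path a e.left)

/-! ## Leavitt path algebras -/

/-- The generators of the Leavitt path algebra: vertices `v`, edges `e`, ghost edges `e^*`. -/
inductive LeavittGen (V : Type u) [Quiver.{v} V] : Type (max u v)
  | vertex (a : V) : LeavittGen V
  | edge (e : Quiver.Total V) : LeavittGen V
  | ghost (e : Quiver.Total V) : LeavittGen V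

/-- The free (not necessarily unital) associative `K`-algebra on the generators. -/
abbrev FreeLeavitt (K : Type w) [Field K] (V : Type u) [Quiver.{v} V] : Type (max u v w) :=
  MonoidAlgebra K (FreeSemigroup (LeavittGen V))

namespace FreeLeavitt

variable (K : Type w) [Field K] {V : Type u} [Quiver.{v} V]

/-- A generator as an element of the free algebra. -/
noncomputable def gen (x : LeavittGen V) : FreeLeavitt K V :=
  MonoidAlgebra.ofMagma K _ (FreeSemigroup.of x)

/-- The vertex `a` in the free algebra. -/
noncomputable abbrev vx (a : V) : FreeLeavitt K V := gen K (.vertex a)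

/-- The edge `e` in the free algebra. -/
noncomputable abbrev ed (e : Quiver.Total V) : FreeLeavitt K V := gen K (.edge e)

/-- The ghost edge `e^*` in the free algebra. -/
noncomputable abbrev gh (e : Quiver.Total V) : FreeLeavitt K V := gen K (.ghost e)

/-- The defining relations of the Leavitt path algebra, closed under scalar multiples, sums and
products. The equivalence relation generated by it is the congruence modulo the two-sided
ideal generated by the relations. -/
inductive Rel : FreeLeavitt K V → FreeLeavitt K V → Prop
  | vertex_mul_ne {a b : V} (h : a ≠ b) : Rel (vx K a * vx K b) 0
  | vertex_mul_self (a : V) : Rel (vx K a * vx K a) (vx K a)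
  | source_mul_edge (e : Quiver.Total V) : Rel (vx K e.left * ed K e) (ed K e)
  | edge_mul_range (e : Quiver.Total V) : Rel (ed K e * vx K e.right) (ed K e)
  | range_mul_ghost (e : Quiver.Total V) : Rel (vx K e.right * gh K e) (gh K e)
  | ghost_mul_source (e : Quiver.Total V) : Rel (gh K e * vx K e.left) (gh K e)
  | ck1_ne {e f : Quiver.Total V} (h : e ≠ f) : Rel (gh K e * ed K f) 0
  | ck1_self (e : Quiver.Total V) : Rel (gh K e * ed K e) (vx K e.right)
  /- The vertex is regular: it emits at least one and only finitely many edges. -/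
  | ck2 (a : V) [Fintype (Quiver.Star a)] [Nonempty (Quiver.Star a)] :
      Rel (vx K a) (∑ e : Quiver.Star a, ed K ⟨a, e.1, e.2⟩ * gh K ⟨a, e.1, e.2⟩)
  | smul (t : K) {x y : FreeLeavitt K V} : Rel x y → Rel (t • x) (t • y)
  | add_right {x y : FreeLeavitt K V} (z : FreeLeavitt K V) : Rel x y → Rel (x + z) (y + z)
  | mul_left (z : FreeLeavitt K V) {x y : FreeLeavitt K V} : Rel x y → Rel (z * x) (z * y)
  | mul_right {x y : FreeLeavitt K V} (z : FreeLeavitt K V) : Rel x y → Rel (x * z) (y * z)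

theorem Rel.add_left (z : FreeLeavitt K V) {x y : FreeLeavitt K V} (h : Rel K x y) :
    Rel K (z + x) (z + y) := by
  rw [add_comm z x, add_comm z y]
  exact h.add_right z

theorem Rel.neg {x y : FreeLeavitt K V} (h : Rel K x y) : Rel K (-x) (-y) := by
  rw [← neg_one_smul K x, ← neg_one_smul K y]
  exact h.smul (-1)

end FreeLeavitt

/-- The Leavitt path algebra of the graph `V` over `K`. It is a nonunital ring in general. -/
def LeavittPathAlgebra (K : Type w) [Field K] (V : Type u) [Quiver.{v} V] : Type (max u v w) :=
  Quot (FreeLeavitt.Rel K (V := V))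

namespace LeavittPathAlgebra

variable (K : Type w) [Field K] (V : Type u) [Quiver.{v} V]

/-- The class of an element of the free algebra. -/
def mk (x : FreeLeavitt K V) : LeavittPathAlgebra K V := Quot.mk _ x

theorem mk_surjective : Function.Surjective (mk K V) := Quot.mk_surjective

noncomputable instance : Zero (LeavittPathAlgebra K V) := ⟨mk K V 0⟩

noncomputable instance : Add (LeavittPathAlgebra K V) :=
  ⟨Quot.map₂ (· + ·) (fun x _ _ h => h.add_left K x) (fun _ _ z h => h.add_right z)⟩

noncomputable instance : Mul (LeavittPathAlgebra K V) :=
  ⟨Quot.map₂ (· * ·) (fun x _ _ h => h.mul_left x) (fun _ _ z h => h.mul_right z)⟩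

noncomputable instance : Neg (LeavittPathAlgebra K V) := ⟨Quot.map (fun x => -x) (fun _ _ h => h.neg K)⟩

noncomputable instance {S : Type*} [Monoid S] [DistribMulAction S K] [IsScalarTower S K K] :
    SMul S (LeavittPathAlgebra K V) :=
  ⟨fun t => Quot.map (fun x => t • x) (fun x y h => by
    have h' := h.smul (t • (1 : K))
    rwa [smul_assoc, smul_assoc, one_smul, one_smul] at h')⟩

noncomputable instance : Sub (LeavittPathAlgebra K V) :=
  ⟨Quot.map₂ (· - ·)
    (fun x y z h => by simpa only [sub_eq_add_neg] using (h.neg K).add_left K x)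
    (fun x y z h => by simpa only [sub_eq_add_neg] using h.add_right (-z))⟩

noncomputable instance : NonUnitalRing (LeavittPathAlgebra K V) :=
  (mk_surjective K V).nonUnitalRing _ rfl (fun _ _ => rfl) (fun _ _ => rfl) (fun _ => rfl)
    (fun _ _ => rfl) (fun _ _ => rfl) (fun _ _ => rfl)

/-- The class map as an additive homomorphism. -/
noncomputable def mkAddHom : FreeLeavitt K V →+ LeavittPathAlgebra K V where
  toFun := mk K V
  map_zero' := rfl
  map_add' _ _ := rfl

noncomputable instance : Module K (LeavittPathAlgebra K V) :=
  (mk_surjective K V).module K (mkAddHom K V) (fun _ _ => rfl)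

instance : IsScalarTower K (LeavittPathAlgebra K V) (LeavittPathAlgebra K V) :=
  ⟨fun t x y => by
    obtain ⟨x, rfl⟩ := mk_surjective K V x
    obtain ⟨y, rfl⟩ := mk_surjective K V y
    exact congrArg (mk K V) (smul_mul_assoc t x y)⟩

instance : SMulCommClass K (LeavittPathAlgebra K V) (LeavittPathAlgebra K V) :=
  ⟨fun t x y => by
    obtain ⟨x, rfl⟩ := mk_surjective K V x
    obtain ⟨y, rfl⟩ := mk_surjective K V y
    exact congrArg (mk K V) (mul_smul_comm t x y).symm⟩

variable {V}

/-- A vertex as an element of the Leavitt path algebra. -/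
noncomputable def vertex (a : V) : LeavittPathAlgebra K V := mk K V (FreeLeavitt.vx K a)

/-- An edge as an element of the Leavitt path algebra. -/
noncomputable def edge (e : Quiver.Total V) : LeavittPathAlgebra K V := mk K V (FreeLeavitt.ed K e)

/-- A ghost edge as an element of the Leavitt path algebra. -/
noncomputable def ghost (e : Quiver.Total V) : LeavittPathAlgebra K V :=
  mk K V (FreeLeavitt.gh K e)

/-- The element `p = e₁ ⋯ e_k` given by a path; a trivial path gives its vertex. -/
noncomputable def ofPath {a : V} : {b : V} → Quiver.Path a b → LeavittPathAlgebra K V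
  | _, .nil => vertex K a
  | _, .cons p e => ofPath p * edge K ⟨_, _, e⟩

/-- The element `p^* = e_k^* ⋯ e₁^*` given by a path; a trivial path gives its vertex. -/
noncomputable def ofPathStar {a : V} : {b : V} → Quiver.Path a b → LeavittPathAlgebra K V
  | _, .nil => vertex K a
  | _, .cons p e => ghost K ⟨_, _, e⟩ * ofPathStar p

variable (V)

/-- The natural `ℤ`-grading: the `d`-component is the span of the elements `p q^*` for paths `p`
and `q` with `|p| - |q| = d`. -/
noncomputable def grading (d : ℤ) : Submodule K (LeavittPathAlgebra K V) :=
  Submodule.span K {x | ∃ (a b a' b' : V) (p : Quiver.Path a b) (q : Quiver.Path a' b'),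
    (p.length : ℤ) - (q.length : ℤ) = d ∧ x = ofPath K p * ofPathStar K q}

end LeavittPathAlgebra

/-! ## Graded matrix rings over `K[x^m, x^{-m}]` -/

/-- `K[x^m, x^{-m}]`, as a subalgebra of the Laurent polynomials `K[x, x^{-1}]`. -/
noncomputable def laurentSubalgebra (K : Type w) [Field K] (m : ℕ) : Subalgebra K K[T;T⁻¹] :=
  Algebra.adjoin K {LaurentPolynomial.T (m : ℤ), LaurentPolynomial.T (-(m : ℤ))}

/-- The grading of `K[x^m, x^{-m}]`: the `d`-component is `K x^d` if `m ∣ d` and zero otherwise. -/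
noncomputable def laurentGrading (K : Type w) [Field K] (m : ℕ) (d : ℤ) :
    Submodule K (laurentSubalgebra K m) :=
  if (m : ℤ) ∣ d then
    (Submodule.span K {LaurentPolynomial.T d}).comap (laurentSubalgebra K m).val.toLinearMap
  else ⊥

/-- The grading of `M_n(A)(γ_1, …, γ_n)`: a matrix is in the `d`-component if its `(i, j)` entry
is in the `(-γ_i + d + γ_j)`-component of `A` for all `i` and `j`. -/
def matrixGrading {K : Type*} {A : Type*} [Semiring K] [Semiring A] [Module K A]
    (𝒜 : ℤ → Submodule K A) {n : ℕ} (γ : Fin n → ℤ) (d : ℤ) :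
    Submodule K (Matrix (Fin n) (Fin n) A) where
  carrier := {M | ∀ i j, M i j ∈ 𝒜 (-γ i + d + γ j)}
  zero_mem' _ _ := (𝒜 _).zero_mem
  add_mem' hM hN i j := (𝒜 _).add_mem (hM i j) (hN i j)
  smul_mem' t _ hM i j := (𝒜 _).smul_mem t (hM i j)

/-- The graded algebra `M_n(K[x^m, x^{-m}])(γ_1, …, γ_n)`. -/
noncomputable abbrev matrixLaurent (K : Type w) [Field K] (m : ℕ) {n : ℕ} (γ : Fin n → ℤ) :
    ℤ → Submodule K (Matrix (Fin n) (Fin n) (laurentSubalgebra K m)) :=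
  matrixGrading (laurentGrading K m) γ

/-- The list of shifts `l_0(0), l_1(1), …, l_{m-1}(m-1)`: `l_0` times `0`, then `l_1` times `1`,
and so on. -/
def blockShifts {m : ℕ} (l : Fin m → ℕ) : Fin (∑ i, l i) → ℤ :=
  fun k => (((finSigmaFinEquiv.symm k).1 : ℕ) : ℤ)

/-- The number of the shifts `γ_1, …, γ_n` which are equal to `i` modulo `m`. -/
def residueCount (m : ℕ) {n : ℕ} (γ : Fin n → ℤ) (i : Fin m) : ℕ :=
  (Finset.univ.filter fun j => γ j % (m : ℤ) = ((i : ℕ) : ℤ)).card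

/-! ## Graded isomorphisms -/

/-- Graded ring isomorphism: there is a ring isomorphism that matches the components. -/
def GradedRingIso {K A B : Type*} [Semiring K] [NonUnitalNonAssocSemiring A]
    [NonUnitalNonAssocSemiring B] [Module K A] [Module K B]
    (𝒜 : ℤ → Submodule K A) (ℬ : ℤ → Submodule K B) : Prop :=
  ∃ φ : A ≃+* B, ∀ (d : ℤ) (x : A), φ x ∈ ℬ d ↔ x ∈ 𝒜 d

/-- Graded `K`-algebra isomorphism: a graded ring isomorphism which is `K`-linear. -/
def GradedAlgIso {K A B : Type*} [Semiring K] [NonUnitalNonAssocSemiring A]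
    [NonUnitalNonAssocSemiring B] [Module K A] [Module K B]
    (𝒜 : ℤ → Submodule K A) (ℬ : ℤ → Submodule K B) : Prop :=
  ∃ φ : A ≃+* B, (∀ (t : K) (x : A), φ (t • x) = t • φ x) ∧
    ∀ (d : ℤ) (x : A), φ x ∈ ℬ d ↔ x ∈ 𝒜 d

/-! Necessity of condition 4: in a Leavitt path algebra, an element of degree `m > 0` is a
combination of products `p q^*` with `|p| > 0`, and such a `p` begins with an edge, which has degree
1. In the matrix ring, the `(i, j)` entry of a degree 1 element has degree `-γ i + 1 + γ j`. If no
shift is congruent to `γ i - 1` modulo `m`, then row `i` of every degree 1 element vanishes, so the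
`(i, i)` entry of every image of a degree `m` element vanishes. The scalar matrix `x^m` contradicts
this. Hence the residues of the shifts are closed under subtracting 1, so all of them occur
(`residueCount_pos_of_gradedRingIso`).

Sufficiency: if all residues occur, choose one index for each. The chosen indices form a cycle of
length `m` along which the shift drops by 1 modulo `m`, and every other index emits a single edge
into that cycle. Sending edges to matrix units of degree 1 represents the Leavitt path algebra of
this comet (`toMatrix`). As every vertex emits one edge `e`, the relation `e e^* = v` makes `p q^*`
depend only on the sources of `p` and `q` and on `|p| - |q|`, exactly the data indexing homogeneous
matrix units, so the representation is bijective.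

Condition 3 comes from permuting the shifts and changing them by multiples of `m`. That condition 4
passes between isomorphic matrix rings needs no classification: realize one ring by a comet and
apply necessity to the other. -/

/-! ## Monomials of `K[x^m, x^{-m}]` -/

section Laurent

variable (K : Type w) [Field K] (m : ℕ)

theorem T_mem_laurentSubalgebra {d : ℤ} (h : (m : ℤ) ∣ d) :
    (LaurentPolynomial.T d : K[T;T⁻¹]) ∈ laurentSubalgebra K m := by
  obtain ⟨k, rfl⟩ := h
  obtain ⟨k, rfl | rfl⟩ := k.eq_nat_or_neg
  · rw [mul_comm, ← LaurentPolynomial.T_pow]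
    exact pow_mem (Algebra.subset_adjoin (by simp)) k
  · rw [show (m : ℤ) * -(k : ℤ) = k * (-(m : ℤ)) by ring, ← LaurentPolynomial.T_pow]
    exact pow_mem (Algebra.subset_adjoin (by simp)) k

open Classical in
/-- The monomial `x^d` of `K[x^m, x^{-m}]`, which is zero if `m` does not divide `d`. -/
noncomputable def laurentMonomial (d : ℤ) : laurentSubalgebra K m :=
  if h : (m : ℤ) ∣ d then ⟨LaurentPolynomial.T d, T_mem_laurentSubalgebra K m h⟩ else 0

variable {K m}

theorem coe_laurentMonomial {d : ℤ} (h : (m : ℤ) ∣ d) :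
    (laurentMonomial K m d : K[T;T⁻¹]) = LaurentPolynomial.T d := by
  rw [laurentMonomial, dif_pos h]

theorem laurentMonomial_of_not_dvd {d : ℤ} (h : ¬ (m : ℤ) ∣ d) : laurentMonomial K m d = 0 :=
  dif_neg h

theorem laurentMonomial_ne_zero {d : ℤ} (h : (m : ℤ) ∣ d) : laurentMonomial K m d ≠ 0 := by
  intro h0
  have h1 := congrArg Subtype.val h0
  rw [coe_laurentMonomial h] at h1
  exact (LaurentPolynomial.isUnit_T d).ne_zero h1

variable (K m) in
@[simp]
theorem laurentMonomial_zero : laurentMonomial K m 0 = 1 :=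
  Subtype.ext (by rw [coe_laurentMonomial (dvd_zero _), LaurentPolynomial.T_zero]; rfl)

theorem laurentMonomial_mul {d : ℤ} (h : (m : ℤ) ∣ d) (d' : ℤ) :
    laurentMonomial K m d * laurentMonomial K m d' = laurentMonomial K m (d + d') := by
  by_cases h' : (m : ℤ) ∣ d'
  · refine Subtype.ext ?_
    rw [MulMemClass.coe_mul, coe_laurentMonomial h, coe_laurentMonomial h',
      coe_laurentMonomial (dvd_add h h'), LaurentPolynomial.T_add]
  -- Divisibility of `d` alone suffices: it forces `d + d'` to be a non-multiple of `m` together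
  -- with `d'`, so both sides vanish.
  · rw [laurentMonomial_of_not_dvd h', mul_zero, laurentMonomial_of_not_dvd]
    rwa [dvd_add_right h]

theorem laurentGrading_eq_span (d : ℤ) :
    laurentGrading K m d = Submodule.span K {laurentMonomial K m d} := by
  rw [laurentGrading]
  split_ifs with h
  · ext x
    simp only [Submodule.mem_comap, Submodule.mem_span_singleton]
    refine exists_congr fun c => ?_
    rw [← coe_laurentMonomial h, ← Subtype.coe_inj]
    rfl
  · rw [laurentMonomial_of_not_dvd h, Submodule.span_zero_singleton]

theorem laurentMonomial_mem (d : ℤ) : laurentMonomial K m d ∈ laurentGrading K m d := by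
  rw [laurentGrading_eq_span]
  exact Submodule.mem_span_singleton_self _

theorem eq_zero_of_mem_laurentGrading {d : ℤ} (h : ¬ (m : ℤ) ∣ d) {x : laurentSubalgebra K m}
    (hx : x ∈ laurentGrading K m d) : x = 0 := by
  rwa [laurentGrading, if_neg h, Submodule.mem_bot] at hx

theorem mul_laurentMonomial_mem {d e : ℤ} (he : (m : ℤ) ∣ e) {x : laurentSubalgebra K m}
    (hx : x ∈ laurentGrading K m d) : laurentMonomial K m e * x ∈ laurentGrading K m (e + d) := by
  rw [laurentGrading_eq_span, Submodule.mem_span_singleton] at hx ⊢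
  obtain ⟨c, rfl⟩ := hx
  exact ⟨c, by rw [mul_smul_comm, laurentMonomial_mul he]⟩

variable (K m) in
-- An adjoined algebra is the span of the monoid generated by its generators, and the monomials
-- already form a monoid.
theorem span_laurentMonomial :
    Submodule.span K (Set.range fun k : ℤ => laurentMonomial K m (m * k)) = ⊤ := by
  have key : ∀ x ∈ laurentSubalgebra K m,
      x ∈ Submodule.span K (Set.range fun k : ℤ => (LaurentPolynomial.T (m * k) : K[T;T⁻¹])) := by
    intro x hx
    rw [laurentSubalgebra, ← Subalgebra.mem_toSubmodule, Algebra.adjoin_eq_span] at hx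
    refine Submodule.span_mono ?_ hx
    intro y hy
    induction hy using Submonoid.closure_induction with
    | mem y hy =>
      rcases hy with rfl | rfl
      · exact ⟨1, by simp⟩
      · exact ⟨-1, by simp⟩
    | one => exact ⟨0, by simp⟩
    | mul y z _ _ hy hz =>
      obtain ⟨k, rfl⟩ := hy
      obtain ⟨l, rfl⟩ := hz
      exact ⟨k + l, by simp only [← LaurentPolynomial.T_add, mul_add]⟩
  rw [eq_top_iff]
  rintro x -
  have hx := key x x.2
  have hmap : Submodule.span K (Set.range fun k : ℤ => (LaurentPolynomial.T (m * k) : K[T;T⁻¹])) =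
      (Submodule.span K (Set.range fun k : ℤ => laurentMonomial K m (m * k))).map
        (laurentSubalgebra K m).val.toLinearMap := by
    rw [Submodule.map_span, ← Set.range_comp]
    congr 2
    funext k
    exact (coe_laurentMonomial (dvd_mul_right _ _)).symm
  rw [hmap] at hx
  obtain ⟨y, hy, hyx⟩ := hx
  rwa [← Subtype.ext (show (y : K[T;T⁻¹]) = x from hyx)]

/-- The linear map on `K[x^m, x^{-m}]` with prescribed values at the monomials. -/
noncomputable def laurentExpand {M : Type*} [AddCommGroup M] [Module K M] (g : ℤ → M) :
    laurentSubalgebra K m →ₗ[K] M :=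
  Finsupp.linearCombination K g ∘ₗ (AddMonoidAlgebra.coeffLinearEquiv K).toLinearMap ∘ₗ
    (laurentSubalgebra K m).val.toLinearMap

theorem laurentExpand_laurentMonomial {M : Type*} [AddCommGroup M] [Module K M] (g : ℤ → M)
    {d : ℤ} (h : (m : ℤ) ∣ d) : laurentExpand g (laurentMonomial K m d) = g d := by
  have h1 : (AddMonoidAlgebra.coeffLinearEquiv K) (laurentMonomial K m d : K[T;T⁻¹]) =
      Finsupp.single d (1 : K) := by
    rw [coe_laurentMonomial h]; rfl
  change Finsupp.linearCombination K g
    ((AddMonoidAlgebra.coeffLinearEquiv K) (laurentMonomial K m d : K[T;T⁻¹])) = _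
  rw [h1, Finsupp.linearCombination_single, one_smul]

end Laurent

/-! ## Graded isomorphisms -/

section GradedIso

variable {K A B C : Type*} [Semiring K] [NonUnitalNonAssocSemiring A]
  [NonUnitalNonAssocSemiring B] [NonUnitalNonAssocSemiring C] [Module K A] [Module K B]
  [Module K C] {𝒜 : ℤ → Submodule K A} {ℬ : ℤ → Submodule K B} {𝒞 : ℤ → Submodule K C}

theorem GradedRingIso.symm (h : GradedRingIso 𝒜 ℬ) : GradedRingIso ℬ 𝒜 := by
  obtain ⟨φ, hφ⟩ := h
  exact ⟨φ.symm, fun d x => by rw [← hφ, φ.apply_symm_apply]⟩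

theorem GradedRingIso.trans (h : GradedRingIso 𝒜 ℬ) (h' : GradedRingIso ℬ 𝒞) :
    GradedRingIso 𝒜 𝒞 := by
  obtain ⟨φ, hφ⟩ := h
  obtain ⟨χ, hχ⟩ := h'
  exact ⟨φ.trans χ, fun d x => (hχ d (φ x)).trans (hφ d x)⟩

variable (𝒜) in
theorem GradedAlgIso.refl : GradedAlgIso 𝒜 𝒜 :=
  ⟨RingEquiv.refl A, fun _ _ => rfl, fun _ _ => Iff.rfl⟩

theorem GradedAlgIso.gradedRingIso (h : GradedAlgIso 𝒜 ℬ) : GradedRingIso 𝒜 ℬ := by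
  obtain ⟨φ, -, hφ⟩ := h
  exact ⟨φ, hφ⟩

end GradedIso

/-! ## Residues of shifts -/

theorem residueCount_pos_iff {m n : ℕ} {γ : Fin n → ℤ} {i : Fin m} :
    0 < residueCount m γ i ↔ ∃ j, γ j % (m : ℤ) = ((i : ℕ) : ℤ) := by
  simp [residueCount, Finset.card_pos, Finset.Nonempty]

theorem residueCount_pos_iff_forall_dvd {m n : ℕ} (hm : 0 < m) {γ : Fin n → ℤ} :
    (∀ i : Fin m, 0 < residueCount m γ i) ↔ ∀ t : ℤ, ∃ j, (m : ℤ) ∣ γ j - t := by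
  simp only [residueCount_pos_iff]
  have hm' : (0 : ℤ) < m := by exact_mod_cast hm
  constructor
  · intro h t
    have h0 := Int.emod_nonneg t hm'.ne'
    have h1 := Int.emod_lt_of_pos t hm'
    obtain ⟨j, hj⟩ := h ⟨(t % m).toNat, by omega⟩
    refine ⟨j, Int.ModEq.dvd ?_⟩
    rw [Int.ModEq, hj]
    simp [Int.toNat_of_nonneg h0]
  · intro h i
    obtain ⟨j, hj⟩ := h i
    refine ⟨j, ?_⟩
    rw [← (Int.modEq_iff_dvd.2 hj : _ % _ = _ % _)]
    exact Int.emod_eq_of_lt (by positivity) (by exact_mod_cast i.2)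

theorem residueCount_blockShifts_pos {m : ℕ} {l : Fin m → ℕ} (hl : ∀ i, 0 < l i) (i : Fin m) :
    0 < residueCount m (blockShifts l) i := by
  rw [residueCount_pos_iff]
  refine ⟨finSigmaFinEquiv ⟨i, ⟨0, hl i⟩⟩, ?_⟩
  rw [blockShifts, Equiv.symm_apply_apply]
  exact Int.emod_eq_of_lt (by positivity) (by exact_mod_cast i.2)

/-- The indices are sorted by residue: they are the disjoint union of the fibres of the residue map,
and the fibre over `i` is enumerated as the `i`-th block. -/
theorem exists_equiv_blockShifts {m n : ℕ} (hm : 0 < m) (γ : Fin n → ℤ) :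
    ∃ σ : Fin n ≃ Fin (∑ i, residueCount m γ i),
      ∀ j, (m : ℤ) ∣ blockShifts (residueCount m γ) (σ j) - γ j := by
  have hm' : (0 : ℤ) < m := by exact_mod_cast hm
  let ρ : Fin n → Fin m := fun j => ⟨(γ j % m).toNat, by
    have h0 := Int.emod_nonneg (γ j) hm'.ne'
    have h1 := Int.emod_lt_of_pos (γ j) hm'
    omega⟩
  have hcard : ∀ i, Fintype.card {j // ρ j = i} = residueCount m γ i := by
    intro i
    rw [Fintype.card_subtype, residueCount]
    congr 1
    ext j
    have h0 := Int.emod_nonneg (γ j) hm'.ne'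
    simp only [Finset.mem_filter, Finset.mem_univ, true_and, ρ, Fin.ext_iff]
    omega
  refine ⟨(Equiv.sigmaFiberEquiv ρ).symm.trans ((Equiv.sigmaCongrRight fun i =>
    Fintype.equivFinOfCardEq (hcard i)).trans finSigmaFinEquiv), fun j => ?_⟩
  have h0 := Int.emod_nonneg (γ j) hm'.ne'
  simp only [blockShifts, Equiv.trans_apply, Equiv.symm_apply_apply]
  change (m : ℤ) ∣ (((γ j % m).toNat : ℕ) : ℤ) - γ j
  rw [Int.toNat_of_nonneg h0]
  exact Int.ModEq.dvd (Int.mod_modEq _ _).symm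

theorem sum_residueCount {m n : ℕ} (hm : 0 < m) (γ : Fin n → ℤ) :
    n = ∑ i, residueCount m γ i := by
  obtain ⟨σ, -⟩ := exists_equiv_blockShifts hm γ
  simpa using Fintype.card_congr σ

/-! ## Changing the shifts of a graded matrix ring -/

section Matrix

variable {K : Type w} [Field K] {m : ℕ}

/-- Reindexing a matrix and conjugating it by a diagonal matrix of monomials. -/
noncomputable def matrixLaurentReindex {n n' : ℕ} (σ : Fin n ≃ Fin n') {a : Fin n → ℤ}
    (ha : ∀ j, (m : ℤ) ∣ a j) :
    Matrix (Fin n) (Fin n) (laurentSubalgebra K m) ≃+*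
      Matrix (Fin n') (Fin n') (laurentSubalgebra K m) where
  toFun M := Matrix.of fun i j =>
    laurentMonomial K m (a (σ.symm j) - a (σ.symm i)) * M (σ.symm i) (σ.symm j)
  invFun N := Matrix.of fun i j => laurentMonomial K m (a i - a j) * N (σ i) (σ j)
  left_inv M := by
    ext1 i j
    simp only [Matrix.of_apply, Equiv.symm_apply_apply]
    rw [← mul_assoc, laurentMonomial_mul (dvd_sub (ha _) (ha _))]
    simp
  right_inv N := by
    ext1 i j
    simp only [Matrix.of_apply, Equiv.apply_symm_apply]
    rw [← mul_assoc, laurentMonomial_mul (dvd_sub (ha _) (ha _))]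
    simp
  map_add' M N := by
    ext1 i j
    simp [mul_add]
  map_mul' M N := by
    ext1 i j
    simp only [Matrix.mul_apply, Matrix.of_apply]
    rw [Finset.mul_sum, ← σ.sum_comp]
    refine Finset.sum_congr rfl fun k _ => ?_
    rw [Equiv.symm_apply_apply, mul_mul_mul_comm, laurentMonomial_mul (dvd_sub (ha _) (ha _))]
    congr 2
    ring

/-- With `a j = γ' (σ j) - γ j`, the factor `x^(a j - a i)` turns degree `-γ i + d + γ j` into `-γ'
(σ i) + d + γ' (σ j)`. -/
theorem gradedAlgIso_matrixLaurent_of_dvd {n n' : ℕ} {γ : Fin n → ℤ} {γ' : Fin n' → ℤ}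
    (σ : Fin n ≃ Fin n') (h : ∀ j, (m : ℤ) ∣ γ' (σ j) - γ j) :
    GradedAlgIso (matrixLaurent K m γ) (matrixLaurent K m γ') := by
  refine ⟨matrixLaurentReindex σ h, fun t M => ?_, fun d M => ⟨fun hM i j => ?_, fun hM i j => ?_⟩⟩
  · ext1 i j
    exact mul_smul_comm t _ _
  · have h1 := mul_laurentMonomial_mem (dvd_sub (h i) (h j)) (hM (σ i) (σ j))
    rw [← (matrixLaurentReindex (K := K) σ h).symm_apply_apply M]
    convert h1 using 1
    · congr 1
      ring
    · simp [matrixLaurentReindex]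
  · have h1 := mul_laurentMonomial_mem (dvd_sub (h (σ.symm j)) (h (σ.symm i)))
      (hM (σ.symm i) (σ.symm j))
    convert h1 using 1
    · congr 1
      simp only [Equiv.apply_symm_apply]
      ring
    · simp [matrixLaurentReindex]

theorem gradedAlgIso_blockShifts (hm : 0 < m) {n : ℕ} (γ : Fin n → ℤ) :
    GradedAlgIso (matrixLaurent K m γ) (matrixLaurent K m (blockShifts (residueCount m γ))) :=
  have ⟨σ, hσ⟩ := exists_equiv_blockShifts hm γ
  gradedAlgIso_matrixLaurent_of_dvd σ hσ

end Matrix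

/-! ## Relations of the Leavitt path algebra -/

namespace LeavittPathAlgebra

variable {K : Type w} [Field K] {V : Type u} [Quiver.{v} V]

theorem vertex_mul_vertex_of_ne {a b : V} (h : a ≠ b) : vertex K a * vertex K b = 0 :=
  Quot.sound (.vertex_mul_ne h)

@[simp]
theorem vertex_mul_self (a : V) : vertex K a * vertex K a = vertex K a :=
  Quot.sound (.vertex_mul_self a)

@[simp]
theorem source_mul_edge (e : Quiver.Total V) : vertex K e.left * edge K e = edge K e :=
  Quot.sound (.source_mul_edge e)

@[simp]
theorem edge_mul_range (e : Quiver.Total V) : edge K e * vertex K e.right = edge K e :=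
  Quot.sound (.edge_mul_range e)

@[simp]
theorem range_mul_ghost (e : Quiver.Total V) : vertex K e.right * ghost K e = ghost K e :=
  Quot.sound (.range_mul_ghost e)

@[simp]
theorem ghost_mul_source (e : Quiver.Total V) : ghost K e * vertex K e.left = ghost K e :=
  Quot.sound (.ghost_mul_source e)

theorem ghost_mul_edge_of_ne {e f : Quiver.Total V} (h : e ≠ f) : ghost K e * edge K f = 0 :=
  Quot.sound (.ck1_ne h)

@[simp]
theorem ghost_mul_edge_self (e : Quiver.Total V) : ghost K e * edge K e = vertex K e.right :=
  Quot.sound (.ck1_self e)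

theorem edge_mem_grading (e : Quiver.Total V) : edge K e ∈ grading K V 1 := by
  refine Submodule.subset_span ⟨e.left, e.right, e.right, e.right, Quiver.Path.nil.cons e.hom,
    Quiver.Path.nil, by simp, ?_⟩
  exact ((congrArg (· * vertex K e.right) (source_mul_edge e)).trans (edge_mul_range e)).symm

/-- A path of positive length starts with an edge. -/
theorem exists_ofPath_eq_edge_mul {a b : V} (p : Quiver.Path a b) {k : ℕ} (h : p.length = k + 1) :
    ∃ (e : Quiver.Total V) (p' : Quiver.Path e.right b),
      p'.length = k ∧ ofPath K p = edge K e * ofPath K p' := by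
  induction p generalizing k with
  | nil => simp at h
  | @cons b c p f ih =>
    cases k with
    | zero =>
      obtain rfl := Quiver.Path.eq_of_length_zero p (by simpa using h)
      obtain rfl := Quiver.Path.eq_nil_of_length_zero p (by simpa using h)
      refine ⟨⟨a, c, f⟩, .nil, rfl, ?_⟩
      exact (source_mul_edge (K := K) ⟨a, c, f⟩).trans (edge_mul_range ⟨a, c, f⟩).symm
    | succ k =>
      obtain ⟨e, p', hp', he⟩ := ih (k := k) (by simpa using h)
      exact ⟨e, p'.cons f, by simp [hp'], by rw [ofPath, ofPath, he, mul_assoc]⟩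

/-- If a graded matrix ring over `K[x^m, x^{-m}]` is a Leavitt path algebra, then its shifts
represent all residues modulo `m`. -/
theorem residueCount_pos_of_gradedRingIso {m n : ℕ} (hm : 0 < m) (hn : 0 < n) {γ : Fin n → ℤ}
    (h : GradedRingIso (matrixLaurent K m γ) (grading K V)) (i : Fin m) :
    0 < residueCount m γ i := by
  obtain ⟨φ, hφ⟩ := h
  have hφ' : ∀ {d x}, x ∈ grading K V d → φ.symm x ∈ matrixLaurent K m γ d := by
    intro d x hx
    rwa [← hφ, φ.apply_symm_apply]
  have step : ∀ i, ∃ j, (m : ℤ) ∣ -γ i + 1 + γ j := by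
    intro i
    by_contra! hi
    -- The isomorphism need not be `K`-linear, so the scalar stays inside `φ.symm`; it is absorbed
    -- into the first edge, which remains of degree 1.
    have key : ∀ x ∈ grading K V (m : ℤ), ∀ c : K, φ.symm (c • x) i i = 0 := by
      intro x hx
      induction hx using Submodule.span_induction with
      | mem x hx =>
        obtain ⟨a, b, a', b', p, q, hpq, rfl⟩ := hx
        intro c
        obtain ⟨e, p', hp', he⟩ := exists_ofPath_eq_edge_mul (K := K) p (k := p.length - 1)
          (by omega)
        rw [he, mul_assoc, ← smul_mul_assoc, map_mul, Matrix.mul_apply]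
        refine Finset.sum_eq_zero fun j _ => ?_
        rw [eq_zero_of_mem_laurentGrading (hi j)
          (hφ' ((grading K V 1).smul_mem c (edge_mem_grading e)) i j), zero_mul]
      | zero => simp
      | add x y _ _ hx hy => intro c; simp [smul_add, hx c, hy c]
      | smul c' x _ hx => intro c; rw [smul_smul]; exact hx _
    -- A scalar matrix `x^m` has degree `m` whatever the shifts are.
    let z : Matrix (Fin n) (Fin n) (laurentSubalgebra K m) :=
      Matrix.diagonal fun _ => laurentMonomial K m m
    have hz : z ∈ matrixLaurent K m γ m := by
      intro j k
      by_cases hjk : j = k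
      · subst hjk
        simpa [z] using laurentMonomial_mem (K := K) (m := m) m
      · simp only [z, Matrix.diagonal_apply_ne _ hjk]
        exact Submodule.zero_mem _
    have h0 := key (φ z) ((hφ _ _).2 hz) 1
    rw [one_smul, φ.symm_apply_apply] at h0
    exact laurentMonomial_ne_zero (K := K) (dvd_refl (m : ℤ)) (by simpa [z] using h0)
  have iter : ∀ k : ℕ, ∃ j, (m : ℤ) ∣ γ j - (γ ⟨0, hn⟩ - k) := by
    intro k
    induction k with
    | zero => exact ⟨⟨0, hn⟩, by simp⟩
    | succ k ih =>
      obtain ⟨j, hj⟩ := ih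
      obtain ⟨j', hj'⟩ := step j
      refine ⟨j', ?_⟩
      have := dvd_add hj hj'
      push_cast
      ring_nf at this ⊢
      exact this
  refine (residueCount_pos_iff_forall_dvd hm).2 (fun t => ?_) i
  have hm' : (0 : ℤ) < m := by exact_mod_cast hm
  -- The residue of `t` is reached from that of `γ 0` by this many subtractions of 1.
  obtain ⟨j, hj⟩ := iter ((γ ⟨0, hn⟩ - t) % m).toNat
  refine ⟨j, ?_⟩
  rw [Int.toNat_of_nonneg (Int.emod_nonneg _ hm'.ne')] at hj
  have := dvd_add hj (Int.dvd_self_sub_emod (x := γ ⟨0, hn⟩ - t) (m := (m : ℤ)))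
  ring_nf at this ⊢
  exact this

end LeavittPathAlgebra

namespace LeavittPathAlgebra

theorem liftMagma_gen {K : Type w} [Field K] {V : Type u} [Quiver.{v} V]
    {A : Type*} [NonUnitalRing A] [Module K A] [IsScalarTower K A A]
    [SMulCommClass K A A] (g : LeavittGen V → A) (x : LeavittGen V) :
    MonoidAlgebra.liftMagma K (FreeSemigroup.lift g) (FreeLeavitt.gen K x) = g x := by
  have h := DFunLike.congr_fun
    ((MonoidAlgebra.liftMagma K).symm_apply_apply (FreeSemigroup.lift g)) (FreeSemigroup.of x)
  rwa [FreeSemigroup.lift_of] at h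

end LeavittPathAlgebra

/-! ## Graphs in which every vertex emits exactly one edge -/

namespace FunctionalGraph

variable {V : Type u} [Quiver.{v} V] [∀ a : V, Unique (Quiver.Star a)]

/-- The range of the only edge emitted by a vertex. -/
def next (a : V) : V := (default : Quiver.Star a).1

/-- The only edge emitted by a vertex. -/
def out (a : V) : Quiver.Total V := ⟨a, next a, (default : Quiver.Star a).2⟩

@[simp]
theorem out_left (a : V) : (out a).left = a := rfl

@[simp]
theorem out_right (a : V) : (out a).right = next a := rfl

theorem eq_out : ∀ e : Quiver.Total V, e = out e.left
  | ⟨a, b, e⟩ => by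
    have h : (⟨b, e⟩ : Quiver.Star a) = default := Unique.eq_default _
    change _ = (⟨a, (default : Quiver.Star a).1, (default : Quiver.Star a).2⟩ : Quiver.Total V)
    rw [← h]

theorem right_eq (e : Quiver.Total V) : e.right = next e.left := by
  conv_lhs => rw [eq_out e]
  rfl

theorem eq_iterate_of_path {a b : V} (p : Quiver.Path a b) : b = next^[p.length] a := by
  induction p with
  | nil => rfl
  | @cons b c p e ih =>
    rw [Quiver.Path.length_cons, Function.iterate_succ_apply', ← ih]
    exact right_eq ⟨b, c, e⟩

/-! ### Cycles -/

open Function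

theorem isGraphCycle_periodicOrbit {a : V} (ha : a ∈ periodicPts (next : V → V)) :
    IsGraphCycle ((periodicOrbit next a).map out) := by
  refine ⟨?_, ?_, ?_⟩
  · intro h
    have h1 := congrArg Cycle.length h
    rw [periodicOrbit_eq_cycle_map] at h1
    simp only [Cycle.map_coe, Cycle.length_coe, List.length_map, List.length_range,
      Cycle.length_nil] at h1
    exact (minimalPeriod_pos_of_mem_periodicPts ha).ne' h1
  · rw [Cycle.chain_map, periodicOrbit_chain' _ ha]
    intro k
    rw [out_right, out_left, iterate_succ_apply']
  · have h : ((periodicOrbit next a).map out).map Quiver.Total.left = periodicOrbit next a := by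
      rw [periodicOrbit]
      simp [Function.comp_def]
    rw [h]
    exact nodup_periodicOrbit

theorem left_eq_iterate_of_isChain {l : List (Quiver.Total V)}
    (h : l.IsChain fun e f => e.right = f.left) (a : V) (h0 : ∀ e ∈ l.head?, e.left = a) (k : ℕ)
    (hk : k < l.length) : l[k].left = next^[k] a := by
  induction k with
  | zero => exact h0 _ (by simp [List.head?_eq_getElem?, hk])
  | succ k ih =>
    rw [iterate_succ_apply', ← ih (by omega), ← right_eq]
    exact (List.isChain_iff_getElem.1 h k hk).symm

/-- Every cycle is the orbit of a periodic vertex. -/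
theorem exists_eq_periodicOrbit {c : Cycle (Quiver.Total V)} (hc : IsGraphCycle c) :
    ∃ a ∈ periodicPts (next : V → V), c = (periodicOrbit next a).map out := by
  induction c using Quotient.inductionOn' with
  | h l =>
  obtain ⟨hnil, hchain, hnodup⟩ := hc
  cases l with
  | nil => exact absurd rfl hnil
  | cons e l =>
  have hchain' := (Cycle.chain_coe_cons _ e l).1 hchain
  rw [← List.cons_append] at hchain'
  have hnodup' : ((e :: l).map Quiver.Total.left).Nodup := hnodup
  -- The first edge is repeated at the end so that the closing condition of the cycle also becomes
  -- an equation between iterates; it yields periodicity.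
  have hget : ∀ k (hk : k < (e :: l ++ [e]).length), (e :: l ++ [e])[k].left = next^[k] e.left :=
    left_eq_iterate_of_isChain hchain' e.left (by simp)
  have hget' : ∀ k (hk : k < (e :: l).length), (e :: l)[k].left = next^[k] e.left := by
    intro k hk
    rw [← hget k (by simp at hk ⊢; omega), List.getElem_append_left hk]
  have hper : IsPeriodicPt next (l.length + 1) e.left := by
    have := hget (l.length + 1) (by simp)
    rw [List.getElem_append_right (by simp)] at this
    simpa [IsPeriodicPt, IsFixedPt] using this.symm
  have hpts : e.left ∈ periodicPts (next : V → V) := ⟨_, Nat.succ_pos _, hper⟩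
  have hmin : minimalPeriod next e.left = l.length + 1 := by
    refine le_antisymm (hper.minimalPeriod_le (Nat.succ_pos _)) ?_
    -- A smaller period would make two edges of the cycle share a source.
    by_contra! hlt
    have h1 := hget' _ hlt
    rw [iterate_minimalPeriod] at h1
    have h3 := (List.nodup_iff_injective_get.1 hnodup')
      (a₁ := ⟨minimalPeriod next e.left, by simpa using hlt⟩) (a₂ := ⟨0, by simp⟩)
      (by rw [List.get_eq_getElem, List.get_eq_getElem, List.getElem_map, h1]; rfl)
    rw [Fin.mk.injEq] at h3
    exact (minimalPeriod_pos_of_mem_periodicPts hpts).ne' h3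
  refine ⟨e.left, hpts, ?_⟩
  rw [periodicOrbit, hmin, Cycle.map_coe]
  refine congrArg (Cycle.ofList) ?_
  refine List.ext_getElem (by simp) fun k h1 h2 => ?_
  rw [eq_out (e :: l)[k], hget' k h1, List.getElem_map, List.getElem_map, List.getElem_range]

/-- Any cycle is a periodic orbit. Its forward orbit meets that of `a`, and periodic orbits that
meet coincide. -/
theorem isComet_of_iterate {a : V} (ha : a ∈ periodicPts (next : V → V))
    (h : ∀ b : V, ∃ k l, next^[k] b = next^[l] a) : IsComet V := by
  refine ⟨(periodicOrbit next a).map out, isGraphCycle_periodicOrbit ha, fun c hc => ?_,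
    fun b => ?_⟩
  · obtain ⟨b, hb, rfl⟩ := exists_eq_periodicOrbit hc
    obtain ⟨k, l, hkl⟩ := h b
    rw [← periodicOrbit_apply_iterate_eq hb k, hkl, periodicOrbit_apply_iterate_eq ha]
  · obtain ⟨k, l, hkl⟩ := h b
    refine ⟨out (next^[l] a), ?_, ?_⟩
    · rw [Cycle.mem_map]
      exact ⟨_, iterate_mem_periodicOrbit ha l, rfl⟩
    · rw [out_left, ← hkl]
      clear hkl
      induction k with
      | zero => exact ⟨.nil⟩
      | succ k ih =>
        obtain ⟨p⟩ := ih
        rw [iterate_succ_apply']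
        exact ⟨p.cons (default : Quiver.Star (next^[k] b)).2⟩

/-! ### The Leavitt path algebra -/

open LeavittPathAlgebra

variable (K : Type w) [Field K]

theorem edge_mul_ghost (a : V) : edge K (out a) * ghost K (out a) = vertex K a := by
  have h : vertex K a = mk K V (∑ e : Quiver.Star a,
      FreeLeavitt.ed K ⟨a, e.1, e.2⟩ * FreeLeavitt.gh K ⟨a, e.1, e.2⟩) :=
    Quot.sound (.ck2 a)
  rw [h, Fintype.sum_unique]
  rfl

/-- The path of length `k` starting at `a`, as an element of the Leavitt path algebra. -/
noncomputable def fwd (a : V) : ℕ → LeavittPathAlgebra K V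
  | 0 => vertex K a
  | k + 1 => fwd a k * edge K (out (next^[k] a))

/-- The ghost path of length `k` ending at `a`, as an element of the Leavitt path algebra. -/
noncomputable def bwd (a : V) : ℕ → LeavittPathAlgebra K V
  | 0 => vertex K a
  | k + 1 => ghost K (out (next^[k] a)) * bwd a k

theorem ofPath_eq_fwd {a b : V} (p : Quiver.Path a b) : ofPath K p = fwd K a p.length := by
  induction p with
  | nil => rfl
  | @cons b c p e ih =>
    rw [ofPath, ih, Quiver.Path.length_cons, fwd, ← eq_iterate_of_path, eq_out ⟨b, c, e⟩]

theorem ofPathStar_eq_bwd {a b : V} (p : Quiver.Path a b) :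
    ofPathStar K p = bwd K a p.length := by
  induction p with
  | nil => rfl
  | @cons b c p e ih =>
    rw [ofPathStar, ih, Quiver.Path.length_cons, bwd, ← eq_iterate_of_path, eq_out ⟨b, c, e⟩]

theorem exists_path_length (a : V) (k : ℕ) : ∃ p : Quiver.Path a (next^[k] a), p.length = k := by
  induction k with
  | zero => exact ⟨.nil, rfl⟩
  | succ k ih =>
    obtain ⟨p, hp⟩ := ih
    rw [iterate_succ_apply']
    exact ⟨p.cons (default : Quiver.Star (next^[k] a)).2, congrArg (· + 1) hp⟩

theorem fwd_mul_bwd_mem (a b : V) (k l : ℕ) {d : ℤ} (h : (k : ℤ) - l = d) :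
    fwd K a k * bwd K b l ∈ grading K V d := by
  obtain ⟨p, hp⟩ := exists_path_length a k
  obtain ⟨q, hq⟩ := exists_path_length b l
  exact Submodule.subset_span ⟨_, _, _, _, p, q, by rw [hp, hq, h],
    by rw [ofPath_eq_fwd, ofPathStar_eq_bwd, hp, hq]⟩

variable {K}

theorem vertex_mul_fwd (a : V) (k : ℕ) : vertex K a * fwd K a k = fwd K a k := by
  induction k with
  | zero => exact vertex_mul_self a
  | succ k ih => rw [fwd, ← mul_assoc, ih]

theorem fwd_mul_vertex (a : V) (k : ℕ) : fwd K a k * vertex K (next^[k] a) = fwd K a k := by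
  cases k with
  | zero => exact vertex_mul_self a
  | succ k =>
    rw [iterate_succ_apply', fwd, mul_assoc]
    exact congrArg _ (edge_mul_range _)

theorem vertex_mul_bwd (a : V) (k : ℕ) : vertex K (next^[k] a) * bwd K a k = bwd K a k := by
  cases k with
  | zero => exact vertex_mul_self a
  | succ k =>
    rw [iterate_succ_apply', bwd, ← mul_assoc]
    exact congrArg (· * _) (range_mul_ghost _)

theorem fwd_succ_left (a : V) (k : ℕ) : fwd K a (k + 1) = edge K (out a) * fwd K (next a) k := by
  induction k with
  | zero =>
    exact (source_mul_edge (out a)).trans (edge_mul_range (out a)).symm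
  | succ k ih => rw [fwd, ih, fwd, mul_assoc, iterate_succ_apply]

theorem fwd_mul_bwd_of_ne {a b : V} {k l : ℕ} (h : next^[k] a ≠ next^[l] b) :
    fwd K a k * bwd K b l = 0 := by
  rw [← fwd_mul_vertex, ← vertex_mul_bwd, mul_assoc, ← mul_assoc (vertex K _),
    vertex_mul_vertex_of_ne h, zero_mul, mul_zero]

/-- Prolonging both paths beyond their common range inserts factors `e e^*`, each of which is a
vertex and is absorbed. -/
theorem fwd_mul_bwd_add {a b : V} {k l : ℕ} (h : next^[k] a = next^[l] b) (t : ℕ) :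
    fwd K a (k + t) * bwd K b (l + t) = fwd K a k * bwd K b l := by
  induction t with
  | zero => rfl
  | succ t ih =>
    have ht : next^[l + t] b = next^[k + t] a := by
      rw [add_comm, iterate_add_apply, ← h, ← iterate_add_apply, add_comm]
    rw [← ih, ← add_assoc, ← add_assoc, fwd, bwd, ht, mul_assoc, ← mul_assoc (edge K _),
      edge_mul_ghost, ← mul_assoc, fwd_mul_vertex]

theorem fwd_mul_bwd_congr {a b : V} {k l k' l' : ℕ} (h : next^[k] a = next^[l] b)
    (h' : next^[k'] a = next^[l'] b) (hd : (k : ℤ) - l = k' - l') :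
    fwd K a k * bwd K b l = fwd K a k' * bwd K b l' := by
  rcases le_total k k' with hk | hk
  · obtain ⟨t, rfl⟩ := Nat.exists_eq_add_of_le hk
    obtain rfl : l' = l + t := by omega
    rw [fwd_mul_bwd_add h]
  · obtain ⟨t, rfl⟩ := Nat.exists_eq_add_of_le hk
    obtain rfl : l = l' + t := by omega
    rw [fwd_mul_bwd_add h']

variable (K V) in
/-- The span of the products of a path and a ghost path. -/
noncomputable def pathSpan : Submodule K (LeavittPathAlgebra K V) :=
  Submodule.span K
    {x | ∃ (a b : V) (k l : ℕ), next^[k] a = next^[l] b ∧ x = fwd K a k * bwd K b l}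

theorem fwd_mul_bwd_mem_pathSpan (a b : V) (k l : ℕ) :
    fwd K a k * bwd K b l ∈ pathSpan V K := by
  by_cases h : next^[k] a = next^[l] b
  · exact Submodule.subset_span ⟨a, b, k, l, h, rfl⟩
  · rw [fwd_mul_bwd_of_ne h]
    exact Submodule.zero_mem _

theorem mk_gen_mem_pathSpan (g : LeavittGen V) : mk K V (FreeLeavitt.gen K g) ∈ pathSpan V K := by
  cases g with
  | vertex a =>
    have h := fwd_mul_bwd_mem_pathSpan (K := K) a a 0 0
    rwa [fwd, bwd, vertex_mul_self] at h
  | edge e =>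
    have h := fwd_mul_bwd_mem_pathSpan (K := K) e.left e.right 1 0
    rwa [fwd_succ_left, ← right_eq, fwd, bwd, mul_assoc, vertex_mul_self, ← eq_out,
      edge_mul_range] at h
  | ghost e =>
    have h := fwd_mul_bwd_mem_pathSpan (K := K) e.right e.left 0 1
    rwa [fwd, bwd, bwd, iterate_zero_apply, ← eq_out, ghost_mul_source, range_mul_ghost] at h

theorem mk_gen_mul_mem_pathSpan (g : LeavittGen V) {x : LeavittPathAlgebra K V}
    (hx : x ∈ pathSpan V K) : mk K V (FreeLeavitt.gen K g) * x ∈ pathSpan V K := by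
  induction hx using Submodule.span_induction with
  | zero => rw [mul_zero]; exact Submodule.zero_mem _
  | add x y _ _ hx hy => rw [mul_add]; exact Submodule.add_mem _ hx hy
  | smul c x _ hx => rw [mul_smul_comm]; exact Submodule.smul_mem _ c hx
  | mem x hx =>
    obtain ⟨a, b, k, l, h, rfl⟩ := hx
    cases g with
    | vertex c =>
      change vertex K c * _ ∈ _
      by_cases hc : c = a
      · subst hc
        rw [← mul_assoc, vertex_mul_fwd]
        exact fwd_mul_bwd_mem_pathSpan _ _ _ _
      · rw [← vertex_mul_fwd, ← mul_assoc, ← mul_assoc, vertex_mul_vertex_of_ne hc]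
        simp
    | edge e =>
      change edge K e * _ ∈ _
      by_cases hc : e.right = a
      · subst hc
        rw [← mul_assoc, right_eq, eq_out e, out_left, ← fwd_succ_left]
        exact fwd_mul_bwd_mem_pathSpan _ _ _ _
      · rw [← vertex_mul_fwd, ← edge_mul_range, mul_assoc, ← mul_assoc, ← mul_assoc,
          mul_assoc (edge K e), ← mul_assoc (vertex K _), vertex_mul_vertex_of_ne hc]
        simp
    | ghost e =>
      change ghost K e * _ ∈ _
      -- Both paths are prolonged by one edge, so that the ghost edge meets an edge even when the
      -- path from `a` is trivial.
      rw [← fwd_mul_bwd_add h 1, fwd_succ_left, ← mul_assoc, ← mul_assoc]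
      by_cases hc : e = out a
      · subst hc
        rw [ghost_mul_edge_self, out_right, vertex_mul_fwd]
        exact fwd_mul_bwd_mem_pathSpan _ _ _ _
      · rw [ghost_mul_edge_of_ne hc]
        simp

/-- The span contains the generators and is stable under left multiplication by them, so it contains
every word. -/
theorem pathSpan_eq_top : pathSpan V K = ⊤ := by
  rw [eq_top_iff]
  rintro x -
  obtain ⟨x, rfl⟩ := mk_surjective K V x
  induction x using MonoidAlgebra.induction_linear with
  | zero => exact Submodule.zero_mem _
  | add x y hx hy => exact Submodule.add_mem _ hx hy
  | single s r =>
    have hs : mk K V (MonoidAlgebra.ofMagma K _ s) ∈ pathSpan V K := by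
      induction s using FreeSemigroup.recOnMul with
      | ih1 g => exact mk_gen_mem_pathSpan g
      | ih2 g s _ hs =>
        rw [map_mul]
        exact mk_gen_mul_mem_pathSpan g hs
    have h := Submodule.smul_mem _ r hs
    have h1 : r • mk K V (MonoidAlgebra.ofMagma K _ s) = mk K V (MonoidAlgebra.single s r) := by
      change mk K V (r • MonoidAlgebra.ofMagma K _ s) = _
      rw [MonoidAlgebra.ofMagma_apply, MonoidAlgebra.smul_single, smul_eq_mul, mul_one]
    rwa [h1] at h

open Classical in
variable (K) in
/-- The element `p q^*` for paths `p` from `a` and `q` from `b` with the same range and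
`|p| - |q| = d`, or zero if there are none. -/
noncomputable def pathUnit (a b : V) (d : ℤ) : LeavittPathAlgebra K V :=
  if h : ∃ k : ℕ × ℕ, (k.1 : ℤ) - k.2 = d ∧ next^[k.1] a = next^[k.2] b then
    fwd K a h.choose.1 * bwd K b h.choose.2
  else 0

theorem pathUnit_eq {a b : V} {k l : ℕ} (h : next^[k] a = next^[l] b) {d : ℤ}
    (hd : (k : ℤ) - l = d) : pathUnit K a b d = fwd K a k * bwd K b l := by
  have hex : ∃ k : ℕ × ℕ, (k.1 : ℤ) - k.2 = d ∧ next^[k.1] a = next^[k.2] b := ⟨(k, l), hd, h⟩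
  rw [pathUnit, dif_pos hex]
  exact fwd_mul_bwd_congr hex.choose_spec.2 h (hex.choose_spec.1.trans hd.symm)

theorem pathUnit_mem (a b : V) (d : ℤ) : pathUnit K a b d ∈ grading K V d := by
  rw [pathUnit]
  split_ifs with h
  · exact fwd_mul_bwd_mem K _ _ _ _ h.choose_spec.1
  · exact Submodule.zero_mem _

/-! ### Universal property of the Leavitt path algebra -/

section Lift

variable {A : Type*} [NonUnitalRing A] [Module K A] [IsScalarTower K A A]
  [SMulCommClass K A A] (p : V → A) (s t : V → A)
  (hpp : ∀ a b, a ≠ b → p a * p b = 0) (hp : ∀ a, p a * p a = p a)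
  (hps : ∀ a, p a * s a = s a) (hsp : ∀ a, s a * p (next a) = s a)
  (hpt : ∀ a, p (next a) * t a = t a) (htp : ∀ a, t a * p a = t a)
  (hts : ∀ a, t a * s a = p (next a)) (hst : ∀ a, s a * t a = p a)

/-- The homomorphism from the Leavitt path algebra given by elements that satisfy the relations. -/
noncomputable def leavittLift : LeavittPathAlgebra K V →ₙₐ[K] A :=
  let g : LeavittGen V → A
    | .vertex a => p a
    | .edge e => s e.left
    | .ghost e => t e.left
  let F : FreeLeavitt K V →ₙₐ[K] A := MonoidAlgebra.liftMagma K (FreeSemigroup.lift g)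
  have hF : ∀ x, F (FreeLeavitt.gen K x) = g x := liftMagma_gen g
  have hrel : ∀ x y, FreeLeavitt.Rel K x y → F x = F y := by
    intro x y h
    induction h with
    | vertex_mul_ne h => simpa [hF, g] using hpp _ _ h
    | vertex_mul_self a => simpa [hF, g] using hp a
    | source_mul_edge e => simpa [hF, g] using hps e.left
    | edge_mul_range e => simpa [hF, g, right_eq] using hsp e.left
    | range_mul_ghost e => simpa [hF, g, right_eq] using hpt e.left
    | ghost_mul_source e => simpa [hF, g] using htp e.left
    | @ck1_ne e f h =>
      -- Different edges have different sources here, so this relation follows from orthogonality of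
      -- the `p a`.
      have h' : e.left ≠ f.left := fun h' => h (by rw [eq_out e, eq_out f, h'])
      rw [map_mul, hF, hF, map_zero]
      change t e.left * s f.left = 0
      rw [← htp, ← hps, mul_assoc, ← mul_assoc (p _), hpp _ _ h', zero_mul, mul_zero]
    | ck1_self e => simpa [hF, g, right_eq] using hts e.left
    | ck2 a =>
      rw [Fintype.sum_unique, map_mul, hF, hF, hF]
      exact (hst a).symm
    | smul c _ ih => rw [map_smul, map_smul, ih]
    | add_right z _ ih => rw [map_add, map_add, ih]
    | mul_left z _ ih => rw [map_mul, map_mul, ih]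
    | mul_right z _ ih => rw [map_mul, map_mul, ih]
  { toFun := Quot.lift F hrel
    map_smul' := by
      rintro c ⟨x⟩
      exact map_smul F c x
    map_zero' := map_zero F
    map_add' := by
      rintro ⟨x⟩ ⟨y⟩
      exact map_add F x y
    map_mul' := by
      rintro ⟨x⟩ ⟨y⟩
      exact map_mul F x y }

theorem leavittLift_vertex (a : V) :
    leavittLift p s t hpp hp hps hsp hpt htp hts hst (vertex K a) = p a :=
  liftMagma_gen _ _

theorem leavittLift_edge (e : Quiver.Total V) :
    leavittLift p s t hpp hp hps hsp hpt htp hts hst (edge K e) = s e.left :=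
  liftMagma_gen _ _

theorem leavittLift_ghost (e : Quiver.Total V) :
    leavittLift p s t hpp hp hps hsp hpt htp hts hst (ghost K e) = t e.left :=
  liftMagma_gen _ _

end Lift

end FunctionalGraph

/-! ## Homogeneous matrix units -/

section MatrixUnit

variable (K : Type w) [Field K] (m : ℕ) {n : ℕ} (γ : Fin n → ℤ)

/-- The matrix unit at `(i, j)` multiplied by the monomial which makes it homogeneous of degree
`d` in `M_n(K[x^m, x^{-m}])(γ_1, …, γ_n)`. -/
noncomputable def matrixUnit (i j : Fin n) (d : ℤ) :
    Matrix (Fin n) (Fin n) (laurentSubalgebra K m) :=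
  Matrix.single i j (laurentMonomial K m (-γ i + d + γ j))

theorem matrixUnit_mem (i j : Fin n) (d : ℤ) : matrixUnit K m γ i j d ∈ matrixLaurent K m γ d := by
  intro i' j'
  rw [matrixUnit, Matrix.single_apply]
  split_ifs with h
  · obtain ⟨rfl, rfl⟩ := h
    exact laurentMonomial_mem _
  · exact Submodule.zero_mem _

variable {m} in
theorem matrixUnit_mul {i j : Fin n} {d : ℤ} (h : (m : ℤ) ∣ -γ i + d + γ j) (k : Fin n) (d' : ℤ) :
    matrixUnit K m γ i j d * matrixUnit K m γ j k d' = matrixUnit K m γ i k (d + d') := by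
  rw [matrixUnit, matrixUnit, matrixUnit, Matrix.single_mul_single_same, laurentMonomial_mul h]
  congr 2
  ring

theorem matrixUnit_mul_of_ne {j j' : Fin n} (h : j ≠ j') (i k : Fin n) (d d' : ℤ) :
    matrixUnit K m γ i j d * matrixUnit K m γ j' k d' = 0 :=
  Matrix.single_mul_single_of_ne _ _ _ _ h _

variable {K m} in
theorem span_matrixUnit :
    Submodule.span K {M | ∃ i j d, (m : ℤ) ∣ -γ i + d + γ j ∧ M = matrixUnit K m γ i j d} = ⊤ := by
  rw [eq_top_iff]
  rintro M -
  rw [Matrix.matrix_eq_sum_single M]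
  refine Submodule.sum_mem _ fun i _ => Submodule.sum_mem _ fun j _ => ?_
  have hx : M i j ∈ Submodule.span K (Set.range fun k : ℤ => laurentMonomial K m (m * k)) := by
    rw [span_laurentMonomial]
    exact Submodule.mem_top
  generalize M i j = x at hx
  induction hx using Submodule.span_induction with
  | mem x hx =>
    obtain ⟨k, rfl⟩ := hx
    -- A monomial `x^e` at position `(i, j)` has degree `e + γ i - γ j`.
    have h : -γ i + (m * k + γ i - γ j) + γ j = m * k := by ring
    refine Submodule.subset_span ⟨i, j, m * k + γ i - γ j, ?_, ?_⟩
    · rw [h]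
      exact dvd_mul_right _ _
    · rw [matrixUnit, h]
  | zero => rw [Matrix.single_zero]; exact Submodule.zero_mem _
  | add x y _ _ hx hy => rw [Matrix.single_add]; exact Submodule.add_mem _ hx hy
  | smul c x _ hx => rw [← Matrix.smul_single]; exact Submodule.smul_mem _ c hx

/-- The linear map on `M_n(K[x^m, x^{-m}])` with prescribed values at the homogeneous matrix
units. -/
noncomputable def matrixExpand {M : Type*} [AddCommGroup M] [Module K M]
    (g : Fin n → Fin n → ℤ → M) : Matrix (Fin n) (Fin n) (laurentSubalgebra K m) →ₗ[K] M :=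
  ∑ i, ∑ j, laurentExpand (fun e => g i j (e + γ i - γ j)) ∘ₗ Matrix.entryLinearMap K _ i j

variable {K m γ}

theorem matrixExpand_matrixUnit {M : Type*} [AddCommGroup M] [Module K M]
    (g : Fin n → Fin n → ℤ → M) {i j : Fin n} {d : ℤ} (h : (m : ℤ) ∣ -γ i + d + γ j) :
    matrixExpand K m γ g (matrixUnit K m γ i j d) = g i j d := by
  simp only [matrixExpand, matrixUnit, LinearMap.sum_apply, LinearMap.comp_apply,
    Matrix.entryLinearMap_apply]
  rw [Finset.sum_eq_single i, Finset.sum_eq_single j, Matrix.single_apply_same,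
    laurentExpand_laurentMonomial _ h]
  · congr 1
    ring
  · intro j' _ hj
    rw [Matrix.single_apply_of_ne _ _ _ _ _ (by tauto), map_zero]
  · simp
  · intro i' _ hi
    refine Finset.sum_eq_zero fun j' _ => ?_
    rw [Matrix.single_apply_of_ne _ _ _ _ _ (by tauto), map_zero]
  · simp

theorem matrixExpand_mem {M : Type*} [AddCommGroup M] [Module K M]
    {g : Fin n → Fin n → ℤ → M} {d : ℤ} {N : Submodule K M} (hg : ∀ i j, g i j d ∈ N)
    {A : Matrix (Fin n) (Fin n) (laurentSubalgebra K m)} (hA : A ∈ matrixLaurent K m γ d) :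
    matrixExpand K m γ g A ∈ N := by
  simp only [matrixExpand, LinearMap.sum_apply, LinearMap.comp_apply, Matrix.entryLinearMap_apply]
  refine Submodule.sum_mem _ fun i _ => Submodule.sum_mem _ fun j _ => ?_
  by_cases h : (m : ℤ) ∣ -γ i + d + γ j
  · have hij := hA i j
    rw [laurentGrading_eq_span, Submodule.mem_span_singleton] at hij
    obtain ⟨c, hc⟩ := hij
    rw [← hc, map_smul, laurentExpand_laurentMonomial _ h]
    refine Submodule.smul_mem _ c ?_
    convert hg i j using 2
    ring
  · rw [eq_zero_of_mem_laurentGrading h (hA i j), map_zero]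
    exact Submodule.zero_mem _

end MatrixUnit

namespace FunctionalGraph

open LeavittPathAlgebra

/-! ### The representation by matrix units and its inverse -/

section Representation

variable {K : Type w} [Field K] {m n : ℕ} {γ : Fin n → ℤ} {V : Type u} [Quiver.{v} V]
  [∀ a : V, Unique (Quiver.Star a)] {ι : V ≃ Fin n}

theorem dvd_neg_degree {i j d : ℤ} (h : (m : ℤ) ∣ -i + d + j) : (m : ℤ) ∣ -j + -d + i := by
  rw [← dvd_neg]
  exact h.trans (dvd_of_eq (by ring))

variable (K) in
/-- The representation of the Leavitt path algebra by homogeneous matrix units. -/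
noncomputable def toMatrix (ι : V ≃ Fin n) (h : ∀ a, (m : ℤ) ∣ -γ (ι a) + 1 + γ (ι (next a))) :
    LeavittPathAlgebra K V →ₙₐ[K] Matrix (Fin n) (Fin n) (laurentSubalgebra K m) :=
  leavittLift (fun a => matrixUnit K m γ (ι a) (ι a) 0)
    (fun a => matrixUnit K m γ (ι a) (ι (next a)) 1)
    (fun a => matrixUnit K m γ (ι (next a)) (ι a) (-1))
    (fun _ _ hab => matrixUnit_mul_of_ne K m γ (ι.injective.ne hab) _ _ _ _)
    (fun _ => matrixUnit_mul K γ (by simp) _ _)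
    (fun _ => by rw [matrixUnit_mul K γ (by simp), zero_add])
    (fun a => by rw [matrixUnit_mul K γ (h a), add_zero])
    (fun _ => by rw [matrixUnit_mul K γ (by simp), zero_add])
    (fun a => by rw [matrixUnit_mul K γ (dvd_neg_degree (h a)), add_zero])
    (fun a => by rw [matrixUnit_mul K γ (dvd_neg_degree (h a)), neg_add_cancel])
    (fun a => by rw [matrixUnit_mul K γ (h a), add_neg_cancel])

variable (h : ∀ a, (m : ℤ) ∣ -γ (ι a) + 1 + γ (ι (next a)))

theorem toMatrix_vertex (a : V) :
    toMatrix K ι h (vertex K a) = matrixUnit K m γ (ι a) (ι a) 0 := by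
  rw [toMatrix, leavittLift_vertex]

theorem toMatrix_edge (a : V) :
    toMatrix K ι h (edge K (out a)) = matrixUnit K m γ (ι a) (ι (next a)) 1 := by
  rw [toMatrix, leavittLift_edge, out_left]

theorem toMatrix_ghost (a : V) :
    toMatrix K ι h (ghost K (out a)) = matrixUnit K m γ (ι (next a)) (ι a) (-1) := by
  rw [toMatrix, leavittLift_ghost, out_left]

include h in
theorem dvd_iterate (a : V) (k : ℕ) : (m : ℤ) ∣ -γ (ι a) + k + γ (ι (next^[k] a)) := by
  induction k with
  | zero => simp
  | succ k ih =>
    rw [Function.iterate_succ_apply']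
    have h1 := dvd_add ih (h (next^[k] a))
    push_cast
    ring_nf at h1 ⊢
    exact h1

theorem toMatrix_fwd (a : V) (k : ℕ) :
    toMatrix K ι h (fwd K a k) = matrixUnit K m γ (ι a) (ι (next^[k] a)) k := by
  induction k with
  | zero => exact toMatrix_vertex h a
  | succ k ih =>
    rw [fwd, map_mul, ih, toMatrix_edge, matrixUnit_mul K γ (dvd_iterate h a k),
      Function.iterate_succ_apply', Nat.cast_succ]

theorem toMatrix_bwd (a : V) (k : ℕ) :
    toMatrix K ι h (bwd K a k) = matrixUnit K m γ (ι (next^[k] a)) (ι a) (-k) := by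
  induction k with
  | zero => exact toMatrix_vertex h a
  | succ k ih =>
    rw [bwd, map_mul, ih, toMatrix_ghost, matrixUnit_mul K γ (dvd_neg_degree (h _)),
      Function.iterate_succ_apply', Nat.cast_succ, neg_add_rev]

theorem toMatrix_fwd_mul_bwd {a b : V} {k l : ℕ} (hkl : next^[k] a = next^[l] b) :
    toMatrix K ι h (fwd K a k * bwd K b l) = matrixUnit K m γ (ι a) (ι b) (k - l) := by
  rw [map_mul, toMatrix_fwd, toMatrix_bwd, ← hkl, matrixUnit_mul K γ (dvd_iterate h a k),
    sub_eq_add_neg]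

theorem toMatrix_mem {d : ℤ} {x : LeavittPathAlgebra K V} (hx : x ∈ grading K V d) :
    toMatrix K ι h x ∈ matrixLaurent K m γ d := by
  induction hx using Submodule.span_induction with
  | mem x hx =>
    obtain ⟨a, b, a', b', p, q, hd, rfl⟩ := hx
    rw [ofPath_eq_fwd, ofPathStar_eq_bwd]
    by_cases hab : next^[p.length] a = next^[q.length] a'
    · rw [toMatrix_fwd_mul_bwd h hab, hd]
      exact matrixUnit_mem _ _ _ _ _ _
    · rw [fwd_mul_bwd_of_ne hab, map_zero]
      exact Submodule.zero_mem _
  | zero => rw [map_zero]; exact Submodule.zero_mem _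
  | add x y _ _ hx hy => rw [map_add]; exact Submodule.add_mem _ hx hy
  | smul c x _ hx => rw [map_smul]; exact Submodule.smul_mem _ c hx

variable (K m γ ι) in
/-- The linear inverse of `toMatrix`. -/
noncomputable def ofMatrix :
    Matrix (Fin n) (Fin n) (laurentSubalgebra K m) →ₗ[K] LeavittPathAlgebra K V :=
  matrixExpand K m γ fun i j d => pathUnit K (ι.symm i) (ι.symm j) d

theorem ofMatrix_toMatrix (x : LeavittPathAlgebra K V) :
    ofMatrix K m γ ι (toMatrix K ι h x) = x := by
  have hx : x ∈ pathSpan V K := by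
    rw [pathSpan_eq_top]
    exact Submodule.mem_top
  induction hx using Submodule.span_induction with
  | mem x hx =>
    obtain ⟨a, b, k, l, hkl, rfl⟩ := hx
    have h1 := dvd_iterate h a k
    have h2 := dvd_iterate h b l
    rw [← hkl] at h2
    have hd : (m : ℤ) ∣ -γ (ι a) + (k - l) + γ (ι b) := by
      have := dvd_sub h1 h2
      ring_nf at this ⊢
      exact this
    rw [toMatrix_fwd_mul_bwd h hkl, ofMatrix, matrixExpand_matrixUnit _ hd, ι.symm_apply_apply,
      ι.symm_apply_apply, pathUnit_eq hkl rfl]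
  | zero => rw [map_zero, map_zero]
  | add x y _ _ hx hy => rw [map_add, map_add, hx, hy]
  | smul c x _ hx => rw [map_smul, map_smul, hx]

/-- The hypothesis `hconn` supplies, for each nonzero homogeneous matrix unit, a product `p q^*`
mapping to it; this is surjectivity. -/
theorem toMatrix_ofMatrix
    (hconn : ∀ a b d, (m : ℤ) ∣ -γ (ι a) + d + γ (ι b) →
      ∃ k l : ℕ, (k : ℤ) - l = d ∧ next^[k] a = next^[l] b)
    (M : Matrix (Fin n) (Fin n) (laurentSubalgebra K m)) :
    toMatrix K ι h (ofMatrix K m γ ι M) = M := by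
  have hM : M ∈ Submodule.span K _ := (span_matrixUnit (K := K) (m := m) γ).symm ▸ Submodule.mem_top
  induction hM using Submodule.span_induction with
  | mem M hM =>
    obtain ⟨i, j, d, hd, rfl⟩ := hM
    obtain ⟨a, rfl⟩ := ι.surjective i
    obtain ⟨b, rfl⟩ := ι.surjective j
    obtain ⟨k, l, hkl, hab⟩ := hconn a b d hd
    rw [ofMatrix, matrixExpand_matrixUnit _ hd, ι.symm_apply_apply, ι.symm_apply_apply,
      pathUnit_eq hab hkl, toMatrix_fwd_mul_bwd h hab, hkl]
  | zero => rw [map_zero, map_zero]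
  | add x y _ _ hx hy => rw [map_add, map_add, hx, hy]
  | smul c x _ hx => rw [map_smul, map_smul, hx]

include h in
theorem gradedAlgIso_matrixLaurent
    (hconn : ∀ a b d, (m : ℤ) ∣ -γ (ι a) + d + γ (ι b) →
      ∃ k l : ℕ, (k : ℤ) - l = d ∧ next^[k] a = next^[l] b) :
    GradedAlgIso (matrixLaurent K m γ) (grading K V) := by
  let φ : LeavittPathAlgebra K V ≃+* Matrix (Fin n) (Fin n) (laurentSubalgebra K m) :=
    { toMatrix K ι h with
      invFun := ofMatrix K m γ ι
      left_inv := ofMatrix_toMatrix h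
      right_inv := toMatrix_ofMatrix h hconn }
  refine ⟨φ.symm, fun t M => map_smul (ofMatrix K m γ ι) t M, fun d M => ⟨fun hM => ?_, fun hM => ?_⟩⟩
  · rw [← toMatrix_ofMatrix h hconn M]
    exact toMatrix_mem h hM
  · exact matrixExpand_mem (fun i j => pathUnit_mem _ _ d) hM

end Representation

/-! ### The comet attached to shifts representing all residues -/

section Comet

variable {n : ℕ}

/-- The graph on `Fin n` with exactly one edge from `j` to `f j` for every `j`. -/
def MapGraph (_f : Fin n → Fin n) : Type u := ULift.{u} (Fin n)

instance (f : Fin n → Fin n) : Quiver.{v} (MapGraph.{u} f) where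
  Hom a b := ULift.{v} (PLift (f a.down = b.down))

instance (f : Fin n → Fin n) (a : MapGraph.{u} f) : Unique (Quiver.Star a) where
  default := ⟨⟨f a.down⟩, ⟨⟨rfl⟩⟩⟩
  uniq := by
    rintro ⟨⟨b⟩, ⟨⟨h⟩⟩⟩
    cases h
    rfl

theorem isFiniteGraph_mapGraph (f : Fin n → Fin n) : IsFiniteGraph.{u, v} (MapGraph.{u} f) := by
  have h : Finite (MapGraph.{u} f) := inferInstanceAs (Finite (ULift (Fin n)))
  refine ⟨h, Finite.of_injective Quiver.Total.left fun e e' he => ?_⟩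
  rw [eq_out e, eq_out e', he]

theorem exists_comet {K : Type w} [Field K] {m : ℕ} (hm : 0 < m) {γ : Fin n → ℤ}
    (hγ : ∀ i : Fin m, 0 < residueCount m γ i) :
    ∃ (V : Type u) (_ : Quiver.{v} V), IsFiniteGraph V ∧ IsComet V ∧
      GradedAlgIso (matrixLaurent K m γ) (LeavittPathAlgebra.grading K V) := by
  rw [residueCount_pos_iff_forall_dvd hm] at hγ
  choose r hr using hγ
  -- `c t` is the chosen index whose shift is congruent to `t`; it depends only on `t` modulo `m`.
  let c : ℤ → Fin n := fun t => r (t % m)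
  have hc : ∀ t, (m : ℤ) ∣ γ (c t) - t := fun t =>
    (dvd_sub (hr (t % m)) (Int.dvd_self_sub_emod (x := t))).trans (dvd_of_eq (by ring))
  have hcc : ∀ s t, (m : ℤ) ∣ s - t → c s = c t := fun s t hst =>
    congrArg r (Int.modEq_iff_dvd.2 hst).symm
  -- Lowering the shift by 1 gives the matrix unit of an edge a nonzero monomial in degree 1.
  let f : Fin n → Fin n := fun j => c (γ j - 1)
  let ι : MapGraph.{u} f ≃ Fin n := Equiv.ulift
  have hnext : ∀ a : MapGraph.{u} f, ι (next a) = c (γ (ι a) - 1) := fun _ => rfl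
  have hiter : ∀ (k : ℕ) (a : MapGraph.{u} f), ι (next^[k + 1] a) = c (γ (ι a) - (k + 1)) := by
    intro k a
    induction k with
    | zero => simpa using hnext a
    | succ k ih =>
      rw [Function.iterate_succ_apply', hnext, ih]
      refine hcc _ _ ?_
      exact (hc (γ (ι a) - (k + 1))).trans (dvd_of_eq (by push_cast; ring))
  have hconn : ∀ (a b : MapGraph.{u} f) (d : ℤ), (m : ℤ) ∣ -γ (ι a) + d + γ (ι b) →
      ∃ k l : ℕ, (k : ℤ) - l = d ∧ next^[k] a = next^[l] b := by
    intro a b d hd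
    -- The extra step moves both vertices among the chosen indices, where congruent shifts mean
    -- equal vertices.
    refine ⟨d.toNat + 1, (-d).toNat + 1, by push_cast; omega, ι.injective ?_⟩
    rw [hiter, hiter]
    refine hcc _ _ ?_
    rw [← dvd_neg]
    exact hd.trans (dvd_of_eq (by omega))
  let a : MapGraph.{u} f := ι.symm (c 0)
  refine ⟨MapGraph f, inferInstance, isFiniteGraph_mapGraph f,
    isComet_of_iterate (a := a) ⟨m, hm, ?_⟩ fun b => ?_,
    gradedAlgIso_matrixLaurent (ι := ι) (fun b => ?_) hconn⟩
  · obtain ⟨k, hk⟩ := Nat.exists_eq_succ_of_ne_zero hm.ne'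
    refine ι.injective ?_
    rw [hk, hiter, ι.apply_symm_apply]
    refine hcc _ _ ?_
    exact (dvd_sub (hc 0) (dvd_refl (m : ℤ))).trans (dvd_of_eq (by omega))
  · obtain ⟨k, l, -, hkl⟩ := hconn b a (γ (ι b) - γ (ι a)) (by ring_nf; exact dvd_zero _)
    exact ⟨k, l, hkl⟩
  · rw [hnext]
    exact (hc (γ (ι b) - 1)).trans (dvd_of_eq (by ring))

end Comet

end FunctionalGraph

/-- The two lists of equivalent conditions are the same, except that the first one uses graded
ring isomorphisms and the second one graded `K`-algebra isomorphisms. -/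
theorem proposition3p5 {K : Type w} [Field K] (m n : ℕ) (hm : 0 < m) (hn : 0 < n)
    (γ : Fin n → ℤ) :
    [ ∃ (V : Type u) (_ : Quiver.{v} V),
        GradedRingIso (matrixLaurent K m γ) (LeavittPathAlgebra.grading K V),
      ∃ (V : Type u) (_ : Quiver.{v} V), IsFiniteGraph V ∧ IsComet V ∧
        GradedRingIso (matrixLaurent K m γ) (LeavittPathAlgebra.grading K V),
      ∃ l : Fin m → ℕ, (∀ i, 0 < l i) ∧ n = ∑ i, l i ∧
        GradedRingIso (matrixLaurent K m γ) (matrixLaurent K m (blockShifts l)),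
      ∀ i : Fin m, 0 < residueCount m γ i,
      ∀ γ' : Fin n → ℤ, GradedRingIso (matrixLaurent K m γ) (matrixLaurent K m γ') →
        ∀ i : Fin m, 0 < residueCount m γ' i ].TFAE ∧
    [ ∃ (V : Type u) (_ : Quiver.{v} V),
        GradedAlgIso (matrixLaurent K m γ) (LeavittPathAlgebra.grading K V),
      ∃ (V : Type u) (_ : Quiver.{v} V), IsFiniteGraph V ∧ IsComet V ∧
        GradedAlgIso (matrixLaurent K m γ) (LeavittPathAlgebra.grading K V),
      ∃ l : Fin m → ℕ, (∀ i, 0 < l i) ∧ n = ∑ i, l i ∧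
        GradedAlgIso (matrixLaurent K m γ) (matrixLaurent K m (blockShifts l)),
      ∀ i : Fin m, 0 < residueCount m γ i,
      ∀ γ' : Fin n → ℤ, GradedAlgIso (matrixLaurent K m γ) (matrixLaurent K m γ') →
        ∀ i : Fin m, 0 < residueCount m γ' i ].TFAE := by
  have h42 : ∀ {n : ℕ} {γ : Fin n → ℤ}, (∀ i : Fin m, 0 < residueCount m γ i) →
      ∃ (V : Type u) (_ : Quiver.{v} V), IsFiniteGraph V ∧ IsComet V ∧
        GradedAlgIso (matrixLaurent K m γ) (LeavittPathAlgebra.grading K V) :=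
    FunctionalGraph.exists_comet hm
  have h14 : (∃ (V : Type u) (_ : Quiver.{v} V),
      GradedRingIso (matrixLaurent K m γ) (LeavittPathAlgebra.grading K V)) →
      ∀ i : Fin m, 0 < residueCount m γ i := fun ⟨_, _, h⟩ =>
    LeavittPathAlgebra.residueCount_pos_of_gradedRingIso hm hn h
  -- The first ring is a Leavitt path algebra by `h42`, hence so is the second, and necessity
  -- applies to it.
  have transfer : ∀ {n n' : ℕ} {γ : Fin n → ℤ} {γ' : Fin n' → ℤ}, 0 < n' →
      GradedRingIso (matrixLaurent K m γ) (matrixLaurent K m γ') →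
      (∀ i : Fin m, 0 < residueCount m γ i) → ∀ i : Fin m, 0 < residueCount m γ' i := by
    intro n n' γ γ' hn' h hγ
    obtain ⟨V, _, -, -, hV⟩ := h42 hγ
    exact LeavittPathAlgebra.residueCount_pos_of_gradedRingIso hm hn'
      (h.symm.trans hV.gradedRingIso)
  constructor
  · tfae_have 1 → 4 := h14
    tfae_have 2 → 1 := fun ⟨V, q, _, _, h⟩ => ⟨V, q, h⟩
    tfae_have 4 → 2 := fun h => by
      obtain ⟨V, q, hf, hc, h⟩ := h42 h
      exact ⟨V, q, hf, hc, h.gradedRingIso⟩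
    tfae_have 4 → 3 := fun h =>
      ⟨residueCount m γ, h, sum_residueCount hm γ, (gradedAlgIso_blockShifts hm γ).gradedRingIso⟩
    tfae_have 3 → 4 := fun ⟨_, hl, _, h⟩ =>
      transfer hn h.symm (residueCount_blockShifts_pos hl)
    tfae_have 4 → 5 := fun h _ h' => transfer hn h' h
    tfae_have 5 → 4 := fun h => h γ (GradedAlgIso.refl _).gradedRingIso
    tfae_finish
  · tfae_have 1 → 4 := fun ⟨V, q, h⟩ => h14 ⟨V, q, h.gradedRingIso⟩
    tfae_have 2 → 1 := fun ⟨V, q, _, _, h⟩ => ⟨V, q, h⟩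
    tfae_have 4 → 2 := h42
    tfae_have 4 → 3 := fun h =>
      ⟨residueCount m γ, h, sum_residueCount hm γ, gradedAlgIso_blockShifts hm γ⟩
    tfae_have 3 → 4 := fun ⟨_, hl, _, h⟩ =>
      transfer hn h.gradedRingIso.symm (residueCount_blockShifts_pos hl)
    tfae_have 4 → 5 := fun h _ h' => transfer hn h'.gradedRingIso h
    tfae_have 5 → 4 := fun h => h γ (GradedAlgIso.refl _)
    tfae_finish
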